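/- For $k=0,1$ let $J_k(x)=\sum_{m\ge 0}\frac{(-1)^m}{m!\,(m+k)!}\left(\frac{x}{2}\right)^{2m+k}$ be the Bessel function of the first kind, and let $j_{0,1}$ be the smallest positive zero of $J_0$. For integrable $f:\mathbb R^2\to\mathbb C$ put $\widehat f(\xi)=\frac1{2\pi}\int_{\mathbb R^2}e^{-ix\cdot\xi}f(x)\,dx$. Let $D=\{x\in\mathbb R^2:|x|\le 1\}$ be the unit disk, and let $\lambda_1(D)$ be the smallest eigenvalue of the Dirichlet problem $-\Delta u=\lambda u$ in the interior of $D$, $u=0$ on $\partial D$ (with real-valued $u\not\equiv0$ that is $C^2$ in the interior of $D$ and continuous on $D$). Let $f=\mathbf 1_D$. Then $\widehat f(\xi)=J_1(|\xi|)/|\xi|$ for $\xi\ne0$, and $$\int_{\mathbb R^2}\frac{|\widehat f(\xi)|^2}{|\xi|}\,d\xi=2\pi\int_0^\infty\frac{J_1(r)^2}{r^2}\,dr=\frac83,$$ where both integrals converge. On the other hand $\int_D|f|^2\,dx=\pi$, the smallest positive zero $j_{0,1}$ and the smallest eigenvalue $\lambda_1(D)$ exist, $\lambda_1(D)=j_{0,1}^2$,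 and $$\lambda_1(D)^{-1/2}\int_D|f|^2\,dx=\frac{\pi}{j_{0,1}}<\frac83=\int_{\mathbb R^2}\frac{|\widehat f(\xi)|^2}{|\xi|}\,d\xi.$$ Consequently the inequality $$\int_{\mathbb R^2}\frac{|\widehat g(\xi)|^2}{|\xi|^{2\alpha}}\,d\xi\le\lambda_1(D)^{-\alpha}\int_D|g|^2\,dx\qquad\text{for all } g\in L^2(D)\text{, extended by } 0 \text{ to }\mathbb R^2,$$ is false on the unit disk $D$ for $\alpha=\tfrac12$. -/

import Mathlib

noncomputable section

namespace DiskFourier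

open MeasureTheory

/-- The Euclidean plane. -/
abbrev Plane : Type := EuclideanSpace ℝ (Fin 2)

/-- Bessel function of the first kind of order `k`, on the real line. The series converges
absolutely for every `x`. -/
def besselJ (k : ℕ) (x : ℝ) : ℝ :=
  ∑' m : ℕ, (-1 : ℝ) ^ m / ((m.factorial : ℝ) * ((m + k).factorial : ℝ)) * (x / 2) ^ (2 * m + k)

/-- The positive zeros of `J₀`. -/
def besselZeros : Set ℝ := {x : ℝ | 0 < x ∧ besselJ 0 x = 0}

/-- `j_{0,1}`, the first positive zero of `J₀`. -/
def j01 : ℝ := sInf besselZeros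

/-- Fourier transform on the plane, `(2π)⁻¹ ∫ exp(-i x·ξ) f(x) dx`. -/
def fourierPlane (f : Plane → ℂ) (ξ : Plane) : ℂ :=
  (1 / (2 * (Real.pi : ℂ))) * ∫ x : Plane, Complex.exp (-Complex.I * ((inner ℝ x ξ : ℝ) : ℂ)) * f x

/-- The unit disk. -/
def unitDisk : Set Plane := Metric.closedBall 0 1

/-- The indicator function of the unit disk. -/
def diskIndicator : Plane → ℂ := unitDisk.indicator (fun _ => 1)

/-- `μ` is an eigenvalue of the Dirichlet problem `-Δu = μ u` in the interior of `D`,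
`u = 0` on the boundary of `D`: there is a classical solution (twice continuously differentiable
inside, continuous up to the boundary) that does not vanish identically. -/
def IsDirichletEigenvalue (D : Set Plane) (μ : ℝ) : Prop :=
  ∃ u : Plane → ℝ,
    ContDiffOn ℝ 2 u (interior D) ∧
    ContinuousOn u (closure D) ∧
    (∀ x ∈ interior D, -(Laplacian.laplacian u x) = μ * u x) ∧
    (∀ x ∈ frontier D, u x = 0) ∧
    ∃ x ∈ interior D, u x ≠ 0

/-- The first (smallest) Dirichlet eigenvalue of `D`. -/
def lambda1 (D : Set Plane) : ℝ := sInf {μ : ℝ | IsDirichletEigenvalue D μ}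

/-- The Fourier-weighted inequality with exponent `α` on `D`: for every `f ∈ L²(D)`, extended
by zero, `∫ |f̂(ξ)|² / |ξ|^{2α} dξ ≤ λ₁(D)^{-α} ∫_D |f|²`; the left-hand side is an integral
in `[0, ∞]`. -/
def FourierWeightedInequality (D : Set Plane) (α : ℝ) : Prop :=
  ∀ f : Plane → ℂ, MemLp f 2 (volume.restrict D) →
    ∫⁻ ξ : Plane, ENNReal.ofReal (‖fourierPlane (D.indicator f) ξ‖ ^ 2 / ‖ξ‖ ^ (2 * α))
      ≤ ENNReal.ofReal (lambda1 D ^ (-α) * ∫ x in D, ‖f x‖ ^ 2)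

end DiskFourier

end

/-! Slicing the disk perpendicular to `ξ` turns its Fourier transform into the one-dimensional
transform of the chord length `2√(1 - t²)`, which Poisson's integral identifies with `J₁(r)/r`, `r =
‖ξ‖` (`fourierPlane_diskIndicator`). In polar coordinates the Jacobian `r` cancels the weight
`1/‖ξ‖`, so the weighted integral is `2π ∫₀^∞ (J₁(r)/r)² dr`. This is again the `L²` norm of the
transform of the semicircle, and Plancherel on the line reduces it to `∫ (1 - t²) dt = 4/3` over
`[-1, 1]` (`integral_besselJ_one_div_sq`), whence `8/3`.

For the eigenvalue, `J₀(j01 ‖x‖)` is an eigenfunction for `j01²`. Nothing smaller occurs: for `κ <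
j01` the function `J₀(κ ‖x‖)` is positive on the closed disk, and comparing an eigenfunction with it
at the maximum of their quotient gives `κ² ≤ μ` (`le_of_positive_solution`). The final strict
inequality needs only `j01 ≥ 2`, which follows from two terms of the alternating series of `J₀`. -/

noncomputable section

namespace DiskFourier

open MeasureTheory Topology
open scoped FourierTransform SchwartzMap ContDiff

/-! ### Plancherel for functions in `L¹ ∩ L²` -/

/-- On `L¹ ∩ L²` the `L²` Fourier transform is given by the Fourier integral. -/
theorem coeFn_fourier_toLp {E : Type*} [NormedAddCommGroup E] [InnerProductSpace ℝ E]
    [FiniteDimensional ℝ E] [MeasurableSpace E] [BorelSpace E] {f : E → ℂ}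
    (h₁ : Integrable f) (h₂ : MemLp f 2) :
    (𝓕 (h₂.toLp f) : Lp ℂ 2 (volume : Measure E)) =ᵐ[volume] 𝓕 f := by
  have hcont : Continuous (𝓕 f) :=
    VectorFourier.fourierIntegral_continuous Real.continuous_fourierChar
      (by exact continuous_inner) h₁
  -- Both sides are tested against smooth compactly supported `g`. Each pairing becomes `∫ (𝓕 G) f`:
  -- one by the definition of the distributional transform, the other by self-adjointness of the
  -- Fourier integral.
  refine ae_eq_of_integral_contDiff_smul_eq
    ((Lp.memLp _).locallyIntegrable (by norm_num)) hcont.locallyIntegrable fun g hg hgs => ?_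
  have hg₁ : HasCompactSupport (Complex.ofRealCLM ∘ g) := hgs.comp_left rfl
  have hg₂ : ContDiff ℝ ∞ (Complex.ofRealCLM ∘ g) := by fun_prop
  set G : 𝓢(E, ℂ) := hg₁.toSchwartzMap hg₂
  have hGg : ∀ x, G x = (g x : ℂ) := fun x => rfl
  calc ∫ x, g x • (𝓕 (h₂.toLp f) : Lp ℂ 2 (volume : Measure E)) x
      = ∫ x, G x • (𝓕 (h₂.toLp f) : Lp ℂ 2 (volume : Measure E)) x := by simp [hGg]
    _ = Lp.toTemperedDistribution (𝓕 (h₂.toLp f) : Lp ℂ 2 (volume : Measure E)) G := by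
        rw [Lp.toTemperedDistribution_apply]
    _ = Lp.toTemperedDistribution (h₂.toLp f) (𝓕 G) := by
        rw [← Lp.fourier_toTemperedDistribution_eq, TemperedDistribution.fourier_apply]
    _ = ∫ x, (𝓕 (G : E → ℂ)) x • f x := by
        rw [Lp.toTemperedDistribution_apply]
        refine integral_congr_ae ?_
        filter_upwards [h₂.coeFn_toLp] with x hx
        rw [hx, SchwartzMap.fourier_coe]
    _ = ∫ x, G x • 𝓕 f x := by
        have := VectorFourier.integral_fourierIntegral_smul_eq_flip (L := innerₗ E)
          (μ := (volume : Measure E)) (ν := (volume : Measure E)) Real.continuous_fourierChar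
          (by exact continuous_inner) G.integrable h₁
        rw [flip_innerₗ] at this
        exact this
    _ = ∫ x, g x • 𝓕 f x := by simp [hGg]

/-- Plancherel's theorem for functions in `L¹ ∩ L²`, with square integrability of the Fourier
integral as part of the conclusion. -/
theorem plancherel_of_integrable_of_memLp {E : Type*} [NormedAddCommGroup E]
    [InnerProductSpace ℝ E] [FiniteDimensional ℝ E] [MeasurableSpace E] [BorelSpace E]
    {f : E → ℂ} (h₁ : Integrable f) (h₂ : MemLp f 2) :
    Integrable (fun w => ‖𝓕 f w‖ ^ 2) ∧ ∫ w, ‖𝓕 f w‖ ^ 2 = ∫ x, ‖f x‖ ^ 2 := by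
  have hae := coeFn_fourier_toLp h₁ h₂
  have hL2 : MemLp (𝓕 f) 2 := (memLp_congr_ae hae).1 (Lp.memLp _)
  have hnorm : ∀ {g : E → ℂ} (hg : MemLp g 2), ∫ x, ‖g x‖ ^ 2 = ‖hg.toLp g‖ ^ 2 := by
    intro g hg
    have h := L2.inner_def (𝕜 := ℂ) (hg.toLp g) (hg.toLp g)
    rw [inner_self_eq_norm_sq_to_K] at h
    have h' : ∫ x, inner ℂ ((hg.toLp g : Lp ℂ 2) x) ((hg.toLp g : Lp ℂ 2) x)
        = ((∫ x, ‖g x‖ ^ 2 : ℝ) : ℂ) := by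
      rw [← integral_complex_ofReal]
      refine integral_congr_ae ?_
      filter_upwards [hg.coeFn_toLp] with x hx
      rw [hx, inner_self_eq_norm_sq_to_K]
      simp
    rw [h'] at h
    exact Complex.ofReal_injective (by push_cast; exact h.symm)
  refine ⟨hL2.integrable_norm_pow (by norm_num), ?_⟩
  rw [hnorm hL2, hnorm h₂]
  congr 1
  rw [← Lp.norm_fourier_eq (h₂.toLp f)]
  congr 1
  exact Lp.ext (hL2.coeFn_toLp.trans hae.symm)

/-! ### Power series with factorially bounded coefficients -/

section PowerSeries

variable {a : ℕ → ℝ}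

theorem summable_of_abs_le_inv_factorial (ha : ∀ m, |a m| ≤ 1 / (m.factorial : ℝ)) (s : ℝ) :
    Summable fun m => a m * s ^ m := by
  refine Summable.of_norm_bounded (Real.summable_pow_div_factorial |s|) fun m => ?_
  rw [Real.norm_eq_abs, abs_mul, abs_pow]
  calc |a m| * |s| ^ m ≤ 1 / (m.factorial : ℝ) * |s| ^ m := by gcongr; exact ha m
    _ = |s| ^ m / m.factorial := by ring

/-- The bound `1 / m!` is stable under termwise differentiation, so smoothness follows by induction
with no new estimate. -/
theorem abs_deriv_coeff_le (ha : ∀ m, |a m| ≤ 1 / (m.factorial : ℝ)) (m : ℕ) :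
    |((m : ℝ) + 1) * a (m + 1)| ≤ 1 / (m.factorial : ℝ) := by
  rw [abs_mul, abs_of_nonneg (by positivity)]
  calc ((m : ℝ) + 1) * |a (m + 1)| ≤ ((m : ℝ) + 1) * (1 / ((m + 1).factorial : ℝ)) := by
        gcongr; exact ha _
    _ = 1 / (m.factorial : ℝ) := by
        rw [Nat.factorial_succ]; push_cast; field_simp

/-- A power series with coefficients bounded by `1 / m!` may be differentiated termwise. -/
theorem hasDerivAt_tsum_pow (ha : ∀ m, |a m| ≤ 1 / (m.factorial : ℝ)) (s : ℝ) :
    HasDerivAt (fun s => ∑' m, a m * s ^ m) (∑' m : ℕ, ((m : ℝ) + 1) * a (m + 1) * s ^ m) s := by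
  set R := |s| + 1
  have hR : 0 ≤ R := by positivity
  have hs : s ∈ Metric.ball (0 : ℝ) R := by simp [R]
  have hsum : Summable fun m : ℕ => |(m : ℝ) * a m| * R ^ (m - 1) := by
    refine (summable_nat_add_iff 1).1 ?_
    have := summable_of_abs_le_inv_factorial (a := fun m : ℕ => |((m : ℝ) + 1) * a (m + 1)|)
      (fun m => by rw [abs_abs]; exact abs_deriv_coeff_le ha m) R
    simpa using this
  have key := hasDerivAt_tsum_of_isPreconnected (g := fun m s => a m * s ^ m)
    (g' := fun m s => a m * (m * s ^ (m - 1))) hsum Metric.isOpen_ball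
    (convex_ball (0 : ℝ) R).isPreconnected
    (fun m y _ => (hasDerivAt_pow m y).const_mul (a m))
    (fun m y hy => by
      have hy' : |y| ≤ R := by simpa using (Metric.mem_ball.1 hy).le
      rw [Real.norm_eq_abs, ← mul_assoc, abs_mul, abs_pow, mul_comm (a m)]
      gcongr) hs
    (summable_of_abs_le_inv_factorial ha s) hs
  convert! key using 1
  have hsum' : Summable fun m : ℕ => a m * (m * s ^ (m - 1)) := by
    refine (summable_nat_add_iff 1).1 ?_
    refine (summable_of_abs_le_inv_factorial (abs_deriv_coeff_le ha) s).congr fun m => ?_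
    simp; ring
  -- The term `m = 0` carries the factor `0`, so the truncated exponent `m - 1` is harmless there.
  rw [hsum'.tsum_eq_zero_add]
  simp only [CharP.cast_eq_zero, zero_mul, mul_zero, zero_add]
  refine tsum_congr fun m => ?_
  simp; ring

theorem contDiff_tsum_pow (n : ℕ) (ha : ∀ m, |a m| ≤ 1 / (m.factorial : ℝ)) :
    ContDiff ℝ n (fun s => ∑' m, a m * s ^ m) := by
  induction n generalizing a with
  | zero =>
    exact contDiff_zero.2 (continuous_iff_continuousAt.2 fun s =>
      (hasDerivAt_tsum_pow ha s).continuousAt)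
  | succ n ih =>
    rw [Nat.cast_succ, contDiff_succ_iff_deriv]
    refine ⟨fun s => (hasDerivAt_tsum_pow ha s).differentiableAt, by simp, ?_⟩
    rw [funext fun s => (hasDerivAt_tsum_pow ha s).deriv]
    exact ih (abs_deriv_coeff_le ha)

end PowerSeries

/-! ### The function `J₀` and its first positive zero -/

/-- The coefficients of the entire function `h` with `J₀(x) = h (x² / 4)`. -/
def profileCoeff (m : ℕ) : ℝ := (-1) ^ m / ((m.factorial : ℝ) * m.factorial)

/-- The entire function `h(s) = ∑ (-1)ᵐ sᵐ / (m!)²`, for which `J₀(x) = h (x² / 4)`. -/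
def besselProfile (s : ℝ) : ℝ := ∑' m, profileCoeff m * s ^ m

theorem abs_profileCoeff_le (m : ℕ) : |profileCoeff m| ≤ 1 / (m.factorial : ℝ) := by
  have h1 : (1 : ℝ) ≤ m.factorial := by exact_mod_cast Nat.one_le_of_lt m.factorial_pos
  rw [profileCoeff, abs_div, abs_pow, abs_neg, abs_one, one_pow,
    abs_of_nonneg (by positivity)]
  gcongr
  nlinarith

/-- Passing to `x² / 4` makes `J₀(κ ‖x‖)` a smooth function of `‖x‖²`, so the origin of the plane
needs no separate treatment. -/
theorem besselJ_zero_eq (x : ℝ) : besselJ 0 x = besselProfile (x ^ 2 / 4) := by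
  refine tsum_congr fun m => ?_
  simp only [profileCoeff, add_zero]
  rw [pow_mul, div_pow]; norm_num

theorem contDiff_besselProfile : ContDiff ℝ 2 besselProfile :=
  contDiff_tsum_pow 2 abs_profileCoeff_le

theorem continuous_besselProfile : Continuous besselProfile := contDiff_besselProfile.continuous

theorem besselProfile_zero : besselProfile 0 = 1 := by
  rw [besselProfile, tsum_eq_single 0 (by intro m hm; simp [hm])]
  simp [profileCoeff]

/-- `h' = h₁`, `h₁' = h₂` with `s h₂ + h₁ = -h`. -/
theorem exists_besselProfile_derivs : ∃ h₁ h₂ : ℝ → ℝ,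
    (∀ s, HasDerivAt besselProfile (h₁ s) s) ∧ (∀ s, HasDerivAt h₁ (h₂ s) s) ∧
    ∀ s, s * h₂ s + h₁ s = -besselProfile s := by
  have hb := abs_deriv_coeff_le abs_profileCoeff_le
  refine ⟨_, _, hasDerivAt_tsum_pow abs_profileCoeff_le, hasDerivAt_tsum_pow hb, fun s => ?_⟩
  have hs1 := summable_of_abs_le_inv_factorial hb s
  have hs2 := summable_of_abs_le_inv_factorial (abs_deriv_coeff_le hb) s
  -- Coefficientwise the equation is `(m + 1)² c (m + 1) = -c m`; the constant term is split off
  -- because `s h₂` has none.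
  rw [besselProfile, ← tsum_mul_left, hs1.tsum_eq_zero_add,
    (summable_of_abs_le_inv_factorial abs_profileCoeff_le s).tsum_eq_zero_add, neg_add,
    ← tsum_neg, add_left_comm, ← (hs2.mul_left s).tsum_add ((summable_nat_add_iff 1).2 hs1)]
  congr 1
  · simp [profileCoeff]
  · refine tsum_congr fun m => ?_
    simp only [profileCoeff, Nat.factorial_succ]
    push_cast
    field_simp
    ring

/-- Consecutive terms have ratio `s / (m + k + 1)²`, at most `1` once `s ≤ k + 1`. The shift `k`
discards initial terms that may still grow. -/
theorem antitone_profile_terms {s : ℝ} (h0 : 0 ≤ s) (k : ℕ) (hk : s ≤ k + 1) :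
    Antitone fun m : ℕ => s ^ (m + k) / (((m + k).factorial : ℝ) * (m + k).factorial) := by
  refine antitone_nat_of_succ_le fun m => ?_
  have hle : s ≤ ((m + k : ℕ) + 1 : ℝ) * ((m + k : ℕ) + 1) := by
    have : (0 : ℝ) ≤ m := by positivity
    have : (0 : ℝ) ≤ k := by positivity
    push_cast
    nlinarith [mul_nonneg ‹(0 : ℝ) ≤ m› ‹(0 : ℝ) ≤ k›]
  rw [show m + 1 + k = m + k + 1 by ring, pow_succ, Nat.factorial_succ,
    div_le_div_iff₀ (by positivity) (by positivity)]
  push_cast at hle ⊢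
  have := mul_le_mul_of_nonneg_left hle
    (show 0 ≤ s ^ (m + k) * (((m + k).factorial : ℝ) * (m + k).factorial) by positivity)
  linarith

theorem summable_profile_terms (s : ℝ) :
    Summable fun m : ℕ => s ^ m / ((m.factorial : ℝ) * m.factorial) := by
  have := summable_of_abs_le_inv_factorial (a := fun m => |profileCoeff m|)
    (fun m => by rw [abs_abs]; exact abs_profileCoeff_le m) s
  refine this.congr fun m => ?_
  rw [profileCoeff, abs_div, abs_pow, abs_neg, abs_one, one_pow, abs_of_nonneg (by positivity)]
  ring

/-- The alternating series is bounded below by its first two terms, `1 - s`. -/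
theorem besselProfile_pos {s : ℝ} (h0 : 0 ≤ s) (h1 : s < 1) : 0 < besselProfile s := by
  have h := (antitone_profile_terms h0 0 (by simpa using h1.le)).alternating_series_le_tendsto
    (summable_profile_terms s).tendsto_alternating_series_tsum 1
  have he : besselProfile s
      = ∑' m : ℕ, (-1) ^ m * (s ^ m / ((m.factorial : ℝ) * m.factorial)) :=
    tsum_congr fun m => by rw [profileCoeff]; ring
  rw [he]
  refine lt_of_lt_of_le ?_ h
  simp [Finset.sum_range_succ]
  linarith

/-- The first two terms give `-1`, and the alternating tail is at most `1 - 2/9 + 1/36 < 1`. The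
point `s = 2` corresponds to `x = √8`. -/
theorem besselProfile_two_neg : besselProfile 2 < 0 := by
  have h := (antitone_profile_terms (s := 2) (by norm_num) 2
    (by norm_num)).tendsto_le_alternating_series
    ((summable_nat_add_iff 2).2 (summable_profile_terms 2)).tendsto_alternating_series_tsum 1
  have he : besselProfile 2
      = 1 - 2 + ∑' m : ℕ, (-1) ^ m *
        ((2 : ℝ) ^ (m + 2) / (((m + 2).factorial : ℝ) * (m + 2).factorial)) := by
    rw [besselProfile,
      ← (summable_of_abs_le_inv_factorial abs_profileCoeff_le 2).sum_add_tsum_nat_add 2]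
    congr 1
    · norm_num [Finset.sum_range_succ, profileCoeff]
    · exact tsum_congr fun m => by rw [profileCoeff]; ring
  rw [he]
  have h' : ∑ i ∈ Finset.range (2 * 1 + 1), (-1 : ℝ) ^ i *
      (2 ^ (i + 2) / (((i + 2).factorial : ℝ) * (i + 2).factorial)) < 1 := by
    norm_num [Finset.sum_range_succ, Nat.factorial]
  linarith

theorem continuous_besselJ_zero : Continuous (besselJ 0) := by
  rw [funext besselJ_zero_eq]
  exact continuous_besselProfile.comp (by fun_prop)

theorem besselZeros_nonempty : besselZeros.Nonempty := by
  have h8 : besselJ 0 (√8) < 0 := by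
    rw [besselJ_zero_eq, Real.sq_sqrt (by norm_num)]
    norm_num [besselProfile_two_neg]
  have h0 : besselJ 0 0 = 1 := by simp [besselJ_zero_eq, besselProfile_zero]
  obtain ⟨x, hx, hx0⟩ := intermediate_value_Icc' (Real.sqrt_nonneg 8)
    continuous_besselJ_zero.continuousOn (show (0 : ℝ) ∈ Set.Icc _ _ from ⟨h8.le, by simp [h0]⟩)
  refine ⟨x, lt_of_le_of_ne hx.1 ?_, hx0⟩
  rintro rfl
  simp [h0] at hx0

theorem two_le_of_mem_besselZeros {x : ℝ} (hx : x ∈ besselZeros) : 2 ≤ x := by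
  by_contra! h
  have h1 := besselProfile_pos (s := x ^ 2 / 4) (by positivity) (by nlinarith [hx.1])
  rw [← besselJ_zero_eq, hx.2] at h1
  exact h1.false

theorem isLeast_j01 : IsLeast besselZeros j01 := by
  have hcl : IsClosed besselZeros := by
    -- The bound `2 ≤ x` replaces the open condition `0 < x` by a closed one, so zeros cannot
    -- accumulate at an excluded endpoint.
    have : besselZeros = Set.Ici 2 ∩ besselJ 0 ⁻¹' {0} := by
      ext x
      exact ⟨fun h => ⟨two_le_of_mem_besselZeros h, h.2⟩,
        fun h => ⟨lt_of_lt_of_le two_pos h.1, h.2⟩⟩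
    rw [this]
    exact isClosed_Ici.inter (isClosed_singleton.preimage continuous_besselJ_zero)
  exact ⟨hcl.csInf_mem besselZeros_nonempty ⟨2, fun x hx => two_le_of_mem_besselZeros hx⟩,
    fun x hx => csInf_le ⟨2, fun x hx => two_le_of_mem_besselZeros hx⟩ hx⟩

theorem two_le_j01 : 2 ≤ j01 := two_le_of_mem_besselZeros isLeast_j01.1

theorem besselJ_zero_pos {x : ℝ} (h0 : 0 ≤ x) (h1 : x < j01) : 0 < besselJ 0 x := by
  by_contra! h
  obtain ⟨y, hy, hy0⟩ := intermediate_value_Icc' h0 continuous_besselJ_zero.continuousOn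
    (show (0 : ℝ) ∈ Set.Icc _ _ from ⟨h, by simp [besselJ_zero_eq, besselProfile_zero]⟩)
  have hpos : 0 < y := lt_of_le_of_ne hy.1 (by
    rintro rfl
    simp [besselJ_zero_eq, besselProfile_zero] at hy0)
  exact absurd (isLeast_j01.2 ⟨hpos, hy0⟩) (by linarith [hy.2])

/-! ### The Laplacian at local maxima and on radial functions -/

section Line

variable {E : Type*} [NormedAddCommGroup E] [InnerProductSpace ℝ E]

/-- The second derivative along a line in terms of the second iterated derivative. -/
theorem iteratedFDeriv_two_eq_deriv_deriv_line {f : E → ℝ} {x : E} (hf : ContDiffAt ℝ 2 f x)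
    (v : E) :
    iteratedFDeriv ℝ 2 f x ![v, v] = deriv (deriv fun t : ℝ => f (x + t • v)) 0 := by
  have hline : ∀ t : ℝ, HasDerivAt (fun t : ℝ => x + t • v) v t := fun t => by
    simpa using ((hasDerivAt_id t).smul_const v).const_add x
  have hcont : Filter.Tendsto (fun t : ℝ => x + t • v) (𝓝 0) (𝓝 x) := by
    simpa using (hline 0).continuousAt.tendsto
  have hev : (deriv fun t : ℝ => f (x + t • v)) =ᶠ[𝓝 0] fun t => fderiv ℝ f (x + t • v) v := by
    have := hcont.eventually (hf.eventually (by simp))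
    filter_upwards [this] with t ht
    exact ((ht.differentiableAt (by norm_num)).hasFDerivAt.comp_hasDerivAt t (hline t)).deriv
  rw [iteratedFDeriv_two_apply, hev.deriv_eq]
  have hd : DifferentiableAt ℝ (fderiv ℝ f) x :=
    (hf.fderiv_right (m := 1) (by norm_num)).differentiableAt (by norm_num)
  have h1 : HasDerivAt (fun t : ℝ => fderiv ℝ f (x + t • v)) (fderiv ℝ (fderiv ℝ f) x v) 0 := by
    have hd' : HasFDerivAt (fderiv ℝ f) (fderiv ℝ (fderiv ℝ f) x) (x + (0 : ℝ) • v) := by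
      simpa using hd.hasFDerivAt
    exact hd'.comp_hasDerivAt 0 (hline 0)
  have h2 := h1.clm_apply (hasDerivAt_const (0 : ℝ) v)
  simpa using h2.deriv.symm

/-- A positive second derivative would make `t` a local minimum as well, so `φ` would be locally
constant and the derivative zero. -/
theorem deriv_deriv_nonpos_of_isLocalMax {φ : ℝ → ℝ} {t : ℝ} (h : IsLocalMax φ t)
    (hc : ContinuousAt φ t) : deriv (deriv φ) t ≤ 0 := by
  by_contra! hpos
  have hmin := isLocalMin_of_deriv_deriv_pos hpos h.deriv_eq_zero hc
  have heq : φ =ᶠ[𝓝 t] fun _ => φ t := by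
    filter_upwards [h, hmin] with s h1 h2 using le_antisymm h1 h2
  have : deriv (deriv φ) t = 0 := by
    rw [heq.deriv.deriv_eq]; simp
  linarith

theorem laplacian_nonpos_of_isLocalMax [FiniteDimensional ℝ E] {f : E → ℝ} {x : E}
    (hf : ContDiffAt ℝ 2 f x) (h : IsLocalMax f x) : Laplacian.laplacian f x ≤ 0 := by
  rw [InnerProductSpace.laplacian_eq_iteratedFDeriv_stdOrthonormalBasis]
  refine Finset.sum_nonpos fun i _ => ?_
  rw [iteratedFDeriv_two_eq_deriv_deriv_line hf]
  set v := stdOrthonormalBasis ℝ E i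
  have hc : Continuous fun t : ℝ => x + t • v := by fun_prop
  have hx : x + (0 : ℝ) • v = x := by simp
  refine deriv_deriv_nonpos_of_isLocalMax ?_ ?_
  · have : IsLocalMax f (x + (0 : ℝ) • v) := by rwa [hx]
    exact this.comp_continuous (g := fun t : ℝ => x + t • v) hc.continuousAt
  · refine ContinuousAt.comp (g := f) ?_ hc.continuousAt
    rw [hx]; exact hf.continuousAt

/-- The Laplacian of a radial function written as a function of `c ‖x‖²`. -/
theorem laplacian_comp_norm_sq [FiniteDimensional ℝ E] {h h₁ h₂ : ℝ → ℝ}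
    (hd₁ : ∀ s, HasDerivAt h (h₁ s) s) (hd₂ : ∀ s, HasDerivAt h₁ (h₂ s) s)
    (hh : ContDiff ℝ 2 h) (c : ℝ) (x : E) :
    Laplacian.laplacian (fun x : E => h (c * ‖x‖ ^ 2)) x
      = 4 * c * (c * ‖x‖ ^ 2 * h₂ (c * ‖x‖ ^ 2))
        + 2 * Module.finrank ℝ E * c * h₁ (c * ‖x‖ ^ 2) := by
  have hC : ContDiff ℝ 2 fun x : E => h (c * ‖x‖ ^ 2) :=
    hh.comp (contDiff_const.mul (contDiff_norm_sq ℝ))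
  have hterm : ∀ v : E, ‖v‖ = 1 →
      iteratedFDeriv ℝ 2 (fun x : E => h (c * ‖x‖ ^ 2)) x ![v, v]
      = 4 * c ^ 2 * h₂ (c * ‖x‖ ^ 2) * inner ℝ v x ^ 2 + 2 * c * h₁ (c * ‖x‖ ^ 2) := by
    intro v hv
    rw [iteratedFDeriv_two_eq_deriv_deriv_line hC.contDiffAt]
    have hq : ∀ t : ℝ, ‖x + t • v‖ ^ 2 = ‖x‖ ^ 2 + 2 * inner ℝ v x * t + t ^ 2 := by
      intro t
      rw [norm_add_sq_real, inner_smul_right, norm_smul, hv, real_inner_comm]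
      simp; ring
    simp only [hq]
    set p := inner ℝ v x
    have hs : ∀ t : ℝ, HasDerivAt (fun t : ℝ => c * (‖x‖ ^ 2 + 2 * p * t + t ^ 2))
        (c * (2 * p + 2 * t)) t := by
      intro t
      have := ((((hasDerivAt_id t).const_mul (2 * p)).const_add (‖x‖ ^ 2)).add
        (hasDerivAt_pow 2 t)).const_mul c
      convert! this using 1
      simp
    have e1 : (deriv fun t : ℝ => h (c * (‖x‖ ^ 2 + 2 * p * t + t ^ 2)))
        = fun t => h₁ (c * (‖x‖ ^ 2 + 2 * p * t + t ^ 2)) * (c * (2 * p + 2 * t)) :=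
      funext fun t => ((hd₁ _).comp t (hs t)).deriv
    rw [e1]
    have hl : HasDerivAt (fun t : ℝ => c * (2 * p + 2 * t)) (c * 2) 0 := by
      simpa using (((hasDerivAt_id (0 : ℝ)).const_mul 2).const_add (2 * p)).const_mul c
    have := (((hd₂ _).comp 0 (hs 0)).mul hl).deriv
    refine Eq.trans ?_ (this.trans ?_)
    · rfl
    · simp; ring
  -- Summing over an orthonormal basis, Parseval turns `∑ ⟨v, x⟩²` into `‖x‖²`.
  rw [InnerProductSpace.laplacian_eq_iteratedFDeriv_stdOrthonormalBasis]
  simp only [hterm _ ((stdOrthonormalBasis ℝ E).norm_eq_one _), Finset.sum_add_distrib,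
    ← Finset.mul_sum, (stdOrthonormalBasis ℝ E).sum_sq_inner_right]
  simp
  ring

end Line

/-! ### The first Dirichlet eigenvalue of the disk -/

/-- The radial function `J₀(κ ‖x‖)` on the plane. -/
def radialBessel (κ : ℝ) (x : Plane) : ℝ := besselJ 0 (κ * ‖x‖)

theorem radialBessel_eq (κ : ℝ) :
    radialBessel κ = fun x : Plane => besselProfile (κ ^ 2 / 4 * ‖x‖ ^ 2) := by
  funext x
  rw [radialBessel, besselJ_zero_eq]
  ring_nf

theorem contDiff_radialBessel (κ : ℝ) : ContDiff ℝ 2 (radialBessel κ) := by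
  rw [radialBessel_eq]
  exact contDiff_besselProfile.comp (contDiff_const.mul (contDiff_norm_sq ℝ))

/-- With `c = κ² / 4` in dimension 2 both terms of the radial Laplacian carry the factor `4c = κ²`,
leaving `κ² (s h₂ + h₁) = -κ² h`. -/
theorem laplacian_radialBessel (κ : ℝ) (x : Plane) :
    Laplacian.laplacian (radialBessel κ) x = -(κ ^ 2 * radialBessel κ x) := by
  obtain ⟨h₁, h₂, hd₁, hd₂, hode⟩ := exists_besselProfile_derivs
  rw [radialBessel_eq, laplacian_comp_norm_sq hd₁ hd₂ contDiff_besselProfile]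
  have := hode (κ ^ 2 / 4 * ‖x‖ ^ 2)
  simp only [finrank_euclideanSpace, Fintype.card_fin]
  push_cast
  linear_combination κ ^ 2 * this

theorem interior_unitDisk : interior unitDisk = Metric.ball 0 1 :=
  interior_closedBall _ one_ne_zero

theorem frontier_unitDisk : frontier unitDisk = Metric.sphere 0 1 :=
  frontier_closedBall _ one_ne_zero

theorem isDirichletEigenvalue_j01_sq : IsDirichletEigenvalue unitDisk (j01 ^ 2) := by
  refine ⟨radialBessel j01, (contDiff_radialBessel _).contDiffOn,
    (contDiff_radialBessel _).continuous.continuousOn, fun x _ => ?_, fun x hx => ?_, 0, ?_, ?_⟩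
  · rw [laplacian_radialBessel, neg_neg]
  · rw [frontier_unitDisk, mem_sphere_zero_iff_norm] at hx
    rw [radialBessel, hx, mul_one]
    exact isLeast_j01.1.2
  · simp [interior_unitDisk]
  · simp [radialBessel, besselJ_zero_eq, besselProfile_zero]

/-- Barta's comparison argument: a positive strict supersolution bounds the eigenvalues from
below. -/
theorem le_of_positive_solution {D : Set Plane} (hD : IsCompact D) {μ ν : ℝ} {v : Plane → ℝ}
    (hv : ContDiff ℝ 2 v) (hpos : ∀ x ∈ D, 0 < v x)
    (hΔ : ∀ x ∈ interior D, Laplacian.laplacian v x = -(ν * v x))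
    (hμ : IsDirichletEigenvalue D μ) : ν ≤ μ := by
  -- Replacing `u` by `-u` if needed, `u` is positive somewhere in the interior.
  suffices key : ∀ u : Plane → ℝ, ContDiffOn ℝ 2 u (interior D) → ContinuousOn u (closure D) →
      (∀ x ∈ interior D, -(Laplacian.laplacian u x) = μ * u x) →
      (∀ x ∈ frontier D, u x = 0) → (∃ x ∈ interior D, 0 < u x) → ν ≤ μ by
    obtain ⟨u, h1, h2, h3, h4, x, hx, hux⟩ := hμ
    rcases lt_or_gt_of_ne hux with hneg | hp
    · refine key (-u) h1.neg h2.neg (fun y hy => ?_) (fun y hy => by simp [h4 y hy])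
        ⟨x, hx, by simpa using hneg⟩
      have := h3 y hy
      rw [InnerProductSpace.laplacian_neg]
      simp only [Pi.neg_apply]
      linarith
    · exact key u h1 h2 h3 h4 ⟨x, hx, hp⟩
  intro u h1 h2 h3 h4 ⟨y, hy, huy⟩
  rw [hD.isClosed.closure_eq] at h2
  have hyD := interior_subset hy
  obtain ⟨x, hxD, hmax⟩ := hD.exists_isMaxOn ⟨y, hyD⟩
    (h2.div hv.continuous.continuousOn fun z hz => (hpos z hz).ne')
  -- The maximum `M` of `u / v` is positive, so it is attained off the boundary, and `u - M v` has a
  -- local maximum there.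
  set M := u x / v x with hM
  have hMpos : 0 < M := lt_of_lt_of_le (div_pos huy (hpos y hyD)) (hmax hyD)
  have hux : u x = M * v x := by rw [hM, div_mul_cancel₀ _ (hpos x hxD).ne']
  have hxi : x ∈ interior D := by
    by_contra hni
    have hfr : x ∈ frontier D := ⟨subset_closure hxD, hni⟩
    rw [hM, h4 x hfr, zero_div] at hMpos
    exact hMpos.false
  have hnhds : interior D ∈ 𝓝 x := isOpen_interior.mem_nhds hxi
  have hu : ContDiffAt ℝ 2 u x := h1.contDiffAt hnhds
  have hMv : ContDiffAt ℝ 2 (M • v) x := contDiffAt_const.smul hv.contDiffAt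
  have hloc : IsLocalMax (u - M • v) x := by
    filter_upwards [hnhds] with z hz
    have hzD := interior_subset hz
    have : u z / v z ≤ M := hmax hzD
    rw [div_le_iff₀ (hpos z hzD)] at this
    simp only [Pi.sub_apply, Pi.smul_apply, smul_eq_mul]
    linarith
  have hle : Laplacian.laplacian (u - M • v) x ≤ 0 :=
    laplacian_nonpos_of_isLocalMax (hu.sub hMv) hloc
  rw [hu.laplacian_sub hMv, InnerProductSpace.laplacian_smul _ hv.contDiffAt, hΔ x hxi,
    smul_eq_mul] at hle
  have h5 := h3 x hxi
  -- Since `u = M v` at `x`, the Laplacian of `u - M v` there equals `(ν - μ) M v`.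
  have h6 : (ν - μ) * (M * v x) ≤ 0 := by
    rw [hux] at h5
    linarith
  by_contra! hlt
  exact absurd h6 (not_le.2 (mul_pos (sub_pos.2 hlt) (mul_pos hMpos (hpos x hxD))))

/-- The comparison function must be positive up to the boundary, which excludes `κ = j01` itself;
the bound `κ² ≤ μ` for `κ < j01` passes to the limit. -/
theorem isLeast_dirichletEigenvalue :
    IsLeast {μ : ℝ | IsDirichletEigenvalue unitDisk μ} (j01 ^ 2) := by
  refine ⟨isDirichletEigenvalue_j01_sq, fun μ hμ => ?_⟩
  have hj := two_le_j01
  have hle : ∀ κ ∈ Set.Ico 0 j01, κ ^ 2 ≤ μ := by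
    intro κ hκ
    refine le_of_positive_solution (isCompact_closedBall _ _) (contDiff_radialBessel κ)
      (fun x hx => ?_) (fun x _ => laplacian_radialBessel κ x) hμ
    have hx1 : ‖x‖ ≤ 1 := by simpa using hx
    refine besselJ_zero_pos (mul_nonneg hκ.1 (norm_nonneg _)) ?_
    exact lt_of_le_of_lt (mul_le_of_le_one_right hκ.1 hx1) hκ.2
  have hcl : IsClosed {κ : ℝ | κ ^ 2 ≤ μ} := isClosed_le (by fun_prop) continuous_const
  have hmem : j01 ∈ closure (Set.Ico 0 j01) := by
    rw [closure_Ico (by linarith)]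
    exact Set.right_mem_Icc.2 (by linarith)
  exact hcl.closure_subset_iff.2 hle hmem

theorem lambda1_unitDisk : lambda1 unitDisk = j01 ^ 2 := isLeast_dirichletEigenvalue.csInf_eq

/-! ### Poisson's integral and the transform of the semicircle -/

theorem integral_cos_pow_add_two (n : ℕ) :
    ∫ θ in (0 : ℝ)..Real.pi, Real.cos θ ^ (n + 2)
      = (n + 1) / (n + 2) * ∫ θ in (0 : ℝ)..Real.pi, Real.cos θ ^ n := by
  rw [integral_cos_pow]; simp

theorem integral_cos_pow_even (m : ℕ) :
    ∫ θ in (0 : ℝ)..Real.pi, Real.cos θ ^ (2 * m)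
      = Real.pi * ((2 * m).factorial : ℝ) / (4 ^ m * ((m.factorial : ℝ) * m.factorial)) := by
  induction m with
  | zero => simp
  | succ m ih =>
    rw [mul_add, mul_one, integral_cos_pow_add_two, ih, Nat.factorial_succ, Nat.factorial_succ,
      Nat.factorial_succ]
    push_cast
    field_simp
    ring

theorem integral_sin_sq_mul_cos_pow_even (m : ℕ) :
    ∫ θ in (0 : ℝ)..Real.pi, Real.sin θ ^ 2 * Real.cos θ ^ (2 * m)
      = Real.pi * ((2 * m).factorial : ℝ)
        / (2 * 4 ^ m * ((m.factorial : ℝ) * (m + 1).factorial)) := by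
  have h : ∀ θ, Real.sin θ ^ 2 * Real.cos θ ^ (2 * m)
      = Real.cos θ ^ (2 * m) - Real.cos θ ^ (2 * m + 2) := fun θ => by
    rw [Real.sin_sq]; ring
  simp only [h]
  rw [intervalIntegral.integral_sub (by apply Continuous.intervalIntegrable; fun_prop)
    (by apply Continuous.intervalIntegrable; fun_prop), integral_cos_pow_add_two,
    integral_cos_pow_even, Nat.factorial_succ]
  push_cast
  field_simp
  ring

/-- Poisson's integral representation of `J₁`. -/
theorem integral_sin_sq_mul_cos_eq_besselJ {r : ℝ} (hr : r ≠ 0) :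
    ∫ θ in (0 : ℝ)..Real.pi, Real.sin θ ^ 2 * Real.cos (r * Real.cos θ)
      = Real.pi * (besselJ 1 r / r) := by
  have hs : HasSum (fun m : ℕ => ∫ θ in (0 : ℝ)..Real.pi,
      Real.sin θ ^ 2 * ((-1) ^ m * (r * Real.cos θ) ^ (2 * m) / (2 * m).factorial))
      (∫ θ in (0 : ℝ)..Real.pi, Real.sin θ ^ 2 * Real.cos (r * Real.cos θ)) := by
    refine intervalIntegral.hasSum_integral_of_dominated_convergence
      -- The cosine series is integrated termwise, dominated by the even part of the series of `exp
      -- |r|`.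
      (fun m _ => |r| ^ (2 * m) / (2 * m).factorial) (fun m => ?_) (fun m => ?_) ?_ ?_ ?_
    · exact Continuous.aestronglyMeasurable (by fun_prop)
    · refine Filter.Eventually.of_forall fun θ _ => ?_
      have h1 : Real.sin θ ^ 2 ≤ 1 := Real.sin_sq_le_one θ
      have h2 : |Real.cos θ| ^ (2 * m) ≤ 1 := pow_le_one₀ (abs_nonneg _) (Real.abs_cos_le_one θ)
      rw [Real.norm_eq_abs, abs_mul, abs_div, abs_mul, abs_pow (-1), abs_neg, abs_one, one_pow,
        one_mul, abs_of_nonneg (sq_nonneg (Real.sin θ)), abs_pow, abs_mul, mul_pow, Nat.abs_cast]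
      calc _ ≤ 1 * (|r| ^ (2 * m) * 1 / (2 * m).factorial) := by gcongr
        _ = _ := by ring
    · refine Filter.Eventually.of_forall fun θ _ => ?_
      exact (Real.summable_pow_div_factorial |r|).comp_injective
        (mul_right_injective₀ (two_ne_zero (α := ℕ)))
    · exact intervalIntegrable_const
    · exact Filter.Eventually.of_forall fun θ _ => (Real.hasSum_cos _).mul_left _
  rw [← hs.tsum_eq, besselJ, ← tsum_div_const, ← tsum_mul_left]
  refine tsum_congr fun m => ?_
  have h : ∀ θ, Real.sin θ ^ 2 * ((-1) ^ m * (r * Real.cos θ) ^ (2 * m) / (2 * m).factorial)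
      = ((-1) ^ m * r ^ (2 * m) / (2 * m).factorial)
        * (Real.sin θ ^ 2 * Real.cos θ ^ (2 * m)) := fun θ => by
    rw [mul_pow]; ring
  simp only [h]
  rw [intervalIntegral.integral_const_mul, integral_sin_sq_mul_cos_pow_even, div_pow, pow_succ,
    pow_succ, pow_mul (2 : ℝ)]
  norm_num
  field_simp

/-- The semicircle profile `√(1 - t²)`; it vanishes for `|t| ≥ 1`. -/
def semicircle (t : ℝ) : ℝ := √(1 - t ^ 2)

theorem continuous_semicircle : Continuous semicircle := by unfold semicircle; fun_prop

theorem semicircle_eq_zero {t : ℝ} (ht : t ∉ Set.Ioc (-1 : ℝ) 1) : semicircle t = 0 := by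
  refine Real.sqrt_eq_zero_of_nonpos ?_
  by_contra! h
  exact ht ⟨by nlinarith, by nlinarith⟩

theorem integral_semicircle_mul {F : Type*} [NormedAddCommGroup F] [NormedSpace ℝ F] (g : ℝ → F) :
    ∫ t, semicircle t • g t = ∫ t in (-1 : ℝ)..1, semicircle t • g t := by
  rw [intervalIntegral.integral_of_le (by norm_num),
    setIntegral_eq_integral_of_forall_compl_eq_zero fun _ ht => by
      rw [semicircle_eq_zero ht, zero_smul]]

theorem hasCompactSupport_semicircle : HasCompactSupport semicircle :=
  HasCompactSupport.intro (isCompact_Icc (a := -1) (b := 1)) fun _ ht =>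
    semicircle_eq_zero fun h => ht (Set.Ioc_subset_Icc_self h)

/-- The substitution `t = cos θ` reduces this to Poisson's integral; one factor `sin θ` comes from
the semicircle, the other from `dt`. -/
theorem integral_semicircle_mul_cos {r : ℝ} (hr : r ≠ 0) :
    ∫ t, semicircle t * Real.cos (r * t) = Real.pi * (besselJ 1 r / r) := by
  have hsub := intervalIntegral.integral_comp_mul_deriv (a := 0) (b := Real.pi)
    (f := Real.cos) (f' := fun θ => -Real.sin θ)
    (g := fun t => semicircle t * Real.cos (r * t))
    (fun θ _ => Real.hasDerivAt_cos θ) (by fun_prop)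
    (continuous_semicircle.mul (by fun_prop))
  have h1 := integral_semicircle_mul fun t => Real.cos (r * t)
  simp only [smul_eq_mul] at h1
  rw [h1, ← integral_sin_sq_mul_cos_eq_besselJ hr]
  rw [Real.cos_zero, Real.cos_pi, intervalIntegral.integral_symm (-1) 1, ← neg_eq_iff_eq_neg,
    ← intervalIntegral.integral_neg] at hsub
  rw [← hsub]
  refine intervalIntegral.integral_congr fun θ hθ => ?_
  rw [Set.uIcc_of_le Real.pi_pos.le] at hθ
  have : semicircle (Real.cos θ) = Real.sin θ := by
    rw [semicircle, ← Real.sin_sq, Real.sqrt_sq (Real.sin_nonneg_of_mem_Icc hθ)]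
  simp only [Function.comp, this]
  ring

/-- The one-dimensional Fourier transform of the semicircle profile. -/
theorem integral_exp_mul_semicircle {r : ℝ} (hr : r ≠ 0) :
    ∫ t : ℝ, Complex.exp (-Complex.I * ((r * t : ℝ) : ℂ)) * (semicircle t : ℂ)
      = ((Real.pi * (besselJ 1 r / r) : ℝ) : ℂ) := by
  have hint : ∀ g : ℝ → ℝ, Continuous g → Integrable fun t => semicircle t * g t := fun g hg =>
    (continuous_semicircle.mul hg).integrable_of_hasCompactSupport
      hasCompactSupport_semicircle.mul_right
  have hodd : ∫ t, semicircle t * Real.sin (r * t) = 0 := by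
    have h := integral_neg_eq_self (fun t => semicircle t * Real.sin (r * t)) volume
    have h' : ∀ t, semicircle (-t) * Real.sin (r * -t) = -(semicircle t * Real.sin (r * t)) :=
      fun t => by simp [semicircle]
    simp only [h', integral_neg] at h
    linarith
  have he : ∀ t : ℝ, Complex.exp (-Complex.I * ((r * t : ℝ) : ℂ)) * (semicircle t : ℂ)
      = ((semicircle t * Real.cos (r * t) : ℝ) : ℂ)
        - Complex.I * ((semicircle t * Real.sin (r * t) : ℝ) : ℂ) := fun t => by
    rw [show -Complex.I * ((r * t : ℝ) : ℂ) = ((-(r * t) : ℝ) : ℂ) * Complex.I by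
      push_cast; ring, Complex.exp_mul_I, ← Complex.ofReal_cos, ← Complex.ofReal_sin,
      Real.cos_neg, Real.sin_neg]
    push_cast; ring
  simp only [he]
  rw [integral_sub (hint _ (by fun_prop)).ofReal ((hint _ (by fun_prop)).ofReal.const_mul _),
    integral_const_mul, integral_complex_ofReal, integral_complex_ofReal, hodd,
    integral_semicircle_mul_cos hr]
  simp

/-! ### The Fourier transform of the disk -/

theorem volume_real_disk_slice (t : ℝ) :
    volume.real {s : ℝ | t ^ 2 + s ^ 2 ≤ 1} = 2 * semicircle t := by
  rcases le_or_gt (t ^ 2) 1 with ht | ht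
  · have : {s : ℝ | t ^ 2 + s ^ 2 ≤ 1} = Set.Icc (-semicircle t) (semicircle t) := by
      ext s
      rw [Set.mem_Icc, ← abs_le, semicircle, Real.le_sqrt (abs_nonneg _) (by linarith), sq_abs,
        Set.mem_ofPred_eq]
      constructor <;> intro h <;> linarith
    have h0 : 0 ≤ semicircle t := Real.sqrt_nonneg _
    rw [this, Real.volume_real_Icc_of_le (by linarith)]
    ring
  · have : {s : ℝ | t ^ 2 + s ^ 2 ≤ 1} = ∅ := by
      ext s
      simp only [Set.mem_ofPred_eq, Set.mem_empty_iff_false, iff_false, not_le]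
      nlinarith [sq_nonneg s]
    rw [this, semicircle, Real.sqrt_eq_zero_of_nonpos (by linarith)]
    simp

theorem diskIndicator_toLp (t s : ℝ) :
    diskIndicator (WithLp.toLp 2 ![t, s])
      = {s : ℝ | t ^ 2 + s ^ 2 ≤ 1}.indicator (fun _ => (1 : ℂ)) s := by
  have : WithLp.toLp 2 ![t, s] ∈ unitDisk ↔ s ∈ {s : ℝ | t ^ 2 + s ^ 2 ≤ 1} := by
    rw [unitDisk, mem_closedBall_zero_iff, EuclideanSpace.norm_eq, Real.sqrt_le_iff]
    simp [Fin.sum_univ_two]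
  by_cases h : s ∈ {s : ℝ | t ^ 2 + s ^ 2 ≤ 1}
  · rw [Set.indicator_of_mem h, diskIndicator, Set.indicator_of_mem (this.2 h)]
  · rw [Set.indicator_of_notMem h, diskIndicator, Set.indicator_of_notMem (mt this.1 h)]

/-- Integrating a function of the first coordinate over the unit disk. -/
theorem integral_unitDisk_slice {g : ℝ → ℂ} (hg : Continuous g) :
    ∫ y : Plane, g (y 0) * diskIndicator y = ∫ t : ℝ, g t * (2 * semicircle t : ℝ) := by
  have hF : Integrable fun y : Plane => g (y 0) * diskIndicator y := by
    have : (fun y : Plane => g (y 0) * diskIndicator y)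
        = unitDisk.indicator fun y : Plane => g (y 0) := by
      funext y
      by_cases hy : y ∈ unitDisk <;> simp [diskIndicator, hy]
    rw [this]
    refine IntegrableOn.integrable_indicator ?_ Metric.isClosed_closedBall.measurableSet
    exact Continuous.continuousOn (by fun_prop) |>.integrableOn_compact (isCompact_closedBall _ _)
  let e : ℝ × ℝ ≃ᵐ Plane := MeasurableEquiv.finTwoArrow.symm.trans (MeasurableEquiv.toLp 2 _)
  have he : MeasurePreserving e := ((volume_preserving_finTwoArrow ℝ).symm).trans
    (PiLp.volume_preserving_toLp (Fin 2))
  have hep : ∀ p, e p = WithLp.toLp 2 ![p.1, p.2] := fun p => rfl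
  rw [← he.integral_comp e.measurableEmbedding]
  have hint := (he.integrable_comp_emb e.measurableEmbedding).2 hF
  rw [Measure.volume_eq_prod] at hint ⊢
  refine (integral_prod _ hint).trans ?_
  refine integral_congr_ae (Filter.Eventually.of_forall fun t => ?_)
  simp only [Function.comp, hep, diskIndicator_toLp, Matrix.cons_val_zero]
  rw [integral_const_mul, integral_indicator_const _
    (measurableSet_le (by fun_prop) measurable_const), volume_real_disk_slice]
  simp

/-- Rotation invariance: `ξ / ‖ξ‖` is completed to an orthonormal basis, and passing to coordinates
preserves both the measure and the disk. -/
theorem integral_exp_diskIndicator {ξ : Plane} (hξ : ξ ≠ 0) :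
    ∫ x : Plane, Complex.exp (-Complex.I * ((inner ℝ x ξ : ℝ) : ℂ)) * diskIndicator x
      = ∫ y : Plane, Complex.exp (-Complex.I * ((‖ξ‖ * y 0 : ℝ) : ℂ)) * diskIndicator y := by
  have hn : ‖ξ‖ ≠ 0 := norm_ne_zero_iff.2 hξ
  obtain ⟨b, hb⟩ := Orthonormal.exists_orthonormalBasis_extension_of_card_eq (𝕜 := ℝ)
    (E := Plane) (ι := Fin 2) (by simp) (v := fun _ => ‖ξ‖⁻¹ • ξ) (s := {0})
    (by
      rw [orthonormal_iff_ite]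
      rintro ⟨i, rfl⟩ ⟨j, rfl⟩
      simp [norm_smul, hn])
  have hb0 : b 0 = ‖ξ‖⁻¹ • ξ := hb 0 rfl
  rw [← b.measurePreserving_repr.integral_comp b.repr.toHomeomorph.measurableEmbedding
    fun y : Plane => Complex.exp (-Complex.I * ((‖ξ‖ * y 0 : ℝ) : ℂ)) * diskIndicator y]
  refine integral_congr_ae (Filter.Eventually.of_forall fun x => ?_)
  have h1 : ‖ξ‖ * b.repr x 0 = inner ℝ x ξ := by
    rw [b.repr_apply_apply, hb0, inner_smul_left, real_inner_comm]
    simp [hn]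
  have h2 : diskIndicator (b.repr x) = diskIndicator x := by
    have : b.repr x ∈ unitDisk ↔ x ∈ unitDisk := by simp [unitDisk]
    by_cases hx : x ∈ unitDisk <;> simp [diskIndicator, hx, this]
  simp only [h1, h2]

theorem fourierPlane_diskIndicator {ξ : Plane} (hξ : ξ ≠ 0) :
    fourierPlane diskIndicator ξ = ((besselJ 1 ‖ξ‖ / ‖ξ‖ : ℝ) : ℂ) := by
  have hpi : (Real.pi : ℂ) ≠ 0 := by exact_mod_cast Real.pi_ne_zero
  rw [fourierPlane, integral_exp_diskIndicator hξ,
    integral_unitDisk_slice (g := fun t => Complex.exp (-Complex.I * ((‖ξ‖ * t : ℝ) : ℂ)))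
      (by fun_prop)]
  have h : ∀ t : ℝ, Complex.exp (-Complex.I * ((‖ξ‖ * t : ℝ) : ℂ)) * ((2 * semicircle t : ℝ) : ℂ)
      = 2 * (Complex.exp (-Complex.I * ((‖ξ‖ * t : ℝ) : ℂ)) * (semicircle t : ℂ)) := fun t => by
    push_cast; ring
  simp only [h]
  rw [integral_const_mul, integral_exp_mul_semicircle (norm_ne_zero_iff.2 hξ)]
  push_cast
  field_simp

/-! ### Evaluation of the weighted integral -/

theorem integral_semicircle_sq : ∫ t, semicircle t ^ 2 = 4 / 3 := by
  have h := integral_semicircle_mul semicircle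
  simp only [smul_eq_mul, ← pow_two] at h
  rw [h]
  have h1 : ∫ t in (-1 : ℝ)..1, semicircle t ^ 2 = ∫ t in (-1 : ℝ)..1, (1 - t ^ 2) := by
    refine intervalIntegral.integral_congr fun t ht => ?_
    rw [Set.uIcc_of_le (by norm_num)] at ht
    exact Real.sq_sqrt (by nlinarith [ht.1, ht.2])
  rw [h1, intervalIntegral.integral_sub (by simp) (by simp), integral_pow]
  norm_num

theorem fourier_semicircle {w : ℝ} (hw : w ≠ 0) :
    𝓕 (fun t => (semicircle t : ℂ)) w
      = ((Real.pi * (besselJ 1 (2 * Real.pi * w) / (2 * Real.pi * w)) : ℝ) : ℂ) := by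
  rw [← integral_exp_mul_semicircle (by positivity : 2 * Real.pi * w ≠ 0), Real.fourier_eq']
  refine integral_congr_ae (Filter.Eventually.of_forall fun t => ?_)
  simp only [smul_eq_mul, RCLike.inner_apply, conj_trivial]
  congr 2
  push_cast
  ring

theorem besselJ_one_neg (x : ℝ) : besselJ 1 (-x) = -besselJ 1 x := by
  rw [besselJ, besselJ, ← tsum_neg]
  refine tsum_congr fun m => ?_
  rw [neg_div, Odd.neg_pow ⟨m, rfl⟩]
  ring

/-- Plancherel's theorem for the semicircle profile, rescaled. -/
theorem integral_besselJ_one_div_sq :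
    Integrable (fun x : ℝ => (besselJ 1 x / x) ^ 2) ∧
      ∫ x : ℝ, (besselJ 1 x / x) ^ 2 = 8 / (3 * Real.pi) := by
  have hpi := Real.pi_pos
  have hc : Continuous fun t => (semicircle t : ℂ) :=
    Complex.continuous_ofReal.comp continuous_semicircle
  have hs : HasCompactSupport fun t => (semicircle t : ℂ) :=
    hasCompactSupport_semicircle.comp_left (g := Complex.ofReal) rfl
  obtain ⟨h1, h2⟩ := plancherel_of_integrable_of_memLp (hc.integrable_of_hasCompactSupport hs)
    (hc.memLp_of_hasCompactSupport hs)
  have hae : (fun w => ‖𝓕 (fun t => (semicircle t : ℂ)) w‖ ^ 2) =ᵐ[volume]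
      fun w => Real.pi ^ 2 * (besselJ 1 (2 * Real.pi * w) / (2 * Real.pi * w)) ^ 2 := by
    have : ∀ᵐ w : ℝ, w ≠ 0 := by simp [ae_iff]
    filter_upwards [this] with w hw
    rw [fourier_semicircle hw, Complex.norm_real, Real.norm_eq_abs, sq_abs, mul_pow]
  rw [integrable_congr hae, integrable_const_mul_iff (by simp [hpi.ne']),
    integrable_comp_mul_left_iff (fun x => (besselJ 1 x / x) ^ 2) (by positivity)] at h1
  -- Rescaling by `2π` turns Plancherel into `π² / (2π) · ∫ (J₁(x)/x)² dx = 4/3`.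
  rw [integral_congr_ae hae, integral_const_mul,
    Measure.integral_comp_mul_left (fun x => (besselJ 1 x / x) ^ 2)] at h2
  simp only [Complex.norm_real, Real.norm_eq_abs, sq_abs, integral_semicircle_sq, smul_eq_mul]
    at h2
  refine ⟨h1, ?_⟩
  rw [abs_of_pos (by positivity)] at h2
  field_simp at h2 ⊢
  linarith

theorem integral_Ioi_besselJ_one :
    IntegrableOn (fun r : ℝ => besselJ 1 r ^ 2 / r ^ 2) (Set.Ioi 0) ∧
      ∫ r in Set.Ioi (0 : ℝ), besselJ 1 r ^ 2 / r ^ 2 = 4 / (3 * Real.pi) := by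
  obtain ⟨h1, h2⟩ := integral_besselJ_one_div_sq
  simp only [div_pow] at h1 h2
  refine ⟨h1.integrableOn, ?_⟩
  have h := integral_comp_abs (f := fun r => besselJ 1 r ^ 2 / r ^ 2)
  have he : ∀ x : ℝ, besselJ 1 |x| ^ 2 / |x| ^ 2 = besselJ 1 x ^ 2 / x ^ 2 := fun x => by
    rcases abs_choice x with hx | hx <;> simp [hx, besselJ_one_neg]
  simp only [he] at h
  rw [h2] at h
  have hpi := Real.pi_pos
  field_simp at h ⊢
  linarith

theorem norm_fourierPlane_ae :
    (fun ξ : Plane => ‖fourierPlane diskIndicator ξ‖ ^ 2 / ‖ξ‖)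
      =ᵐ[volume] fun ξ => (fun r => (besselJ 1 r / r) ^ 2 / r) ‖ξ‖ := by
  have : ∀ᵐ ξ : Plane, ξ ≠ 0 := by simp [ae_iff]
  filter_upwards [this] with ξ hξ
  rw [fourierPlane_diskIndicator hξ, Complex.norm_real, Real.norm_eq_abs, sq_abs]

/-- The polar Jacobian `r` cancels the weight `1 / r`; this makes the planar integral accessible to
Plancherel on the line. -/
theorem radial_weight_eqOn :
    Set.EqOn (fun r : ℝ => r ^ (Module.finrank ℝ Plane - 1) • ((besselJ 1 r / r) ^ 2 / r))
      (fun r => besselJ 1 r ^ 2 / r ^ 2) (Set.Ioi 0) := by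
  intro r hr
  have : r ≠ 0 := (Set.mem_Ioi.1 hr).ne'
  simp only [finrank_euclideanSpace, Fintype.card_fin, smul_eq_mul]
  norm_num
  field_simp

theorem integrable_fourierPlane_weighted :
    Integrable fun ξ : Plane => ‖fourierPlane diskIndicator ξ‖ ^ 2 / ‖ξ‖ := by
  rw [integrable_congr norm_fourierPlane_ae,
    integrable_fun_norm_addHaar volume (f := fun r => (besselJ 1 r / r) ^ 2 / r),
    integrableOn_congr_fun radial_weight_eqOn measurableSet_Ioi]
  exact integral_Ioi_besselJ_one.1

theorem integral_fourierPlane_weighted :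
    ∫ ξ : Plane, ‖fourierPlane diskIndicator ξ‖ ^ 2 / ‖ξ‖
      = 2 * Real.pi * ∫ r in Set.Ioi (0 : ℝ), besselJ 1 r ^ 2 / r ^ 2 := by
  rw [integral_congr_ae norm_fourierPlane_ae,
    integral_fun_norm_addHaar volume (fun r => (besselJ 1 r / r) ^ 2 / r),
    setIntegral_congr_fun measurableSet_Ioi radial_weight_eqOn, measureReal_def,
    EuclideanSpace.volume_ball_fin_two]
  simp [Real.pi_pos.le, mul_assoc]

/-! ### Failure of the inequality -/

theorem integral_norm_diskIndicator_sq :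
    ∫ x in unitDisk, ‖diskIndicator x‖ ^ 2 = Real.pi := by
  have hm : MeasurableSet unitDisk := Metric.isClosed_closedBall.measurableSet
  rw [setIntegral_congr_fun (g := fun _ => (1 : ℝ)) hm
    (fun x hx => by simp [diskIndicator, hx]), setIntegral_const, measureReal_def, unitDisk,
    EuclideanSpace.volume_closedBall_fin_two]
  simp [Real.pi_pos.le]

/-- Crude bounds suffice: `3π < 12 < 16 ≤ 8 j01`. -/
theorem pi_div_j01_lt : Real.pi / j01 < 8 / 3 := by
  have h := two_le_j01
  rw [div_lt_div_iff₀ (by linarith) (by norm_num)]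
  linarith [Real.pi_lt_four]

theorem lambda1_rpow_mul_integral :
    lambda1 unitDisk ^ (-(1 / 2) : ℝ) * (∫ x in unitDisk, ‖diskIndicator x‖ ^ 2)
      = Real.pi / j01 := by
  have h : 0 ≤ j01 := by linarith [two_le_j01]
  rw [integral_norm_diskIndicator_sq, lambda1_unitDisk, Real.rpow_neg (by positivity),
    ← Real.sqrt_eq_rpow, Real.sqrt_sq h]
  ring

theorem integral_fourierPlane_weighted_eq :
    ∫ ξ : Plane, ‖fourierPlane diskIndicator ξ‖ ^ 2 / ‖ξ‖ = 8 / 3 := by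
  rw [integral_fourierPlane_weighted, integral_Ioi_besselJ_one.2]
  have := Real.pi_pos
  field_simp
  norm_num

theorem not_fourierWeightedInequality : ¬ FourierWeightedInequality unitDisk (1 / 2) := by
  intro h
  have hm : MeasurableSet unitDisk := Metric.isClosed_closedBall.measurableSet
  have hfin : IsFiniteMeasure (volume.restrict unitDisk) :=
    ⟨by simp [unitDisk]⟩
  have hmem : MemLp diskIndicator 2 (volume.restrict unitDisk) :=
    (memLp_const (1 : ℂ)).indicator hm
  have h1 := h diskIndicator hmem
  have hind : unitDisk.indicator diskIndicator = diskIndicator := by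
    simp [diskIndicator, Set.indicator_indicator]
  simp only [hind, show (2 : ℝ) * (1 / 2) = 1 by norm_num, Real.rpow_one] at h1
  -- Integrability turns the `[0, ∞]`-valued integral into the real number `8/3`, so the hypothesis
  -- reads `8/3 ≤ π / j01`.
  rw [lambda1_rpow_mul_integral, ← ofReal_integral_eq_lintegral_ofReal
    integrable_fourierPlane_weighted (Filter.Eventually.of_forall fun ξ => by positivity),
    integral_fourierPlane_weighted_eq, ENNReal.ofReal_le_ofReal_iff
      (div_nonneg Real.pi_pos.le (by linarith [two_le_j01]))] at h1
  linarith [pi_div_j01_lt]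

end DiskFourier

end
open DiskFourier MeasureTheory in
theorem mainTheorem5 :
    -- the Fourier transform of the indicator function of the disk
    (∀ ξ : Plane, ξ ≠ 0 →
      fourierPlane diskIndicator ξ = ((besselJ 1 ‖ξ‖ / ‖ξ‖ : ℝ) : ℂ)) ∧
    -- the value of the Fourier-weighted integral
    Integrable (fun ξ : Plane => ‖fourierPlane diskIndicator ξ‖ ^ 2 / ‖ξ‖) ∧
    IntegrableOn (fun r : ℝ => besselJ 1 r ^ 2 / r ^ 2) (Set.Ioi 0) ∧
    (∫ ξ : Plane, ‖fourierPlane diskIndicator ξ‖ ^ 2 / ‖ξ‖)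
      = 2 * Real.pi * ∫ r in Set.Ioi (0 : ℝ), besselJ 1 r ^ 2 / r ^ 2 ∧
    (∫ ξ : Plane, ‖fourierPlane diskIndicator ξ‖ ^ 2 / ‖ξ‖) = 8 / 3 ∧
    -- `j_{0,1}` and the first Dirichlet eigenvalue are attained, and `λ₁ = j_{0,1}²`
    IsLeast besselZeros j01 ∧
    IsLeast {μ : ℝ | IsDirichletEigenvalue unitDisk μ} (lambda1 unitDisk) ∧
    lambda1 unitDisk = j01 ^ 2 ∧
    -- the right-hand side of the inequality
    (∫ x in unitDisk, ‖diskIndicator x‖ ^ 2) = Real.pi ∧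
    lambda1 unitDisk ^ (-(1 / 2) : ℝ) * (∫ x in unitDisk, ‖diskIndicator x‖ ^ 2)
      = Real.pi / j01 ∧
    Real.pi / j01 < 8 / 3 ∧
    -- the inequality fails for the indicator function, hence on the disk with exponent `1/2`
    lambda1 unitDisk ^ (-(1 / 2) : ℝ) * (∫ x in unitDisk, ‖diskIndicator x‖ ^ 2)
      < (∫ ξ : Plane, ‖fourierPlane diskIndicator ξ‖ ^ 2 / ‖ξ‖) ∧
    ¬ FourierWeightedInequality unitDisk (1 / 2) := by
  refine ⟨fun ξ hξ => fourierPlane_diskIndicator hξ, integrable_fourierPlane_weighted,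
    integral_Ioi_besselJ_one.1, integral_fourierPlane_weighted, integral_fourierPlane_weighted_eq,
    isLeast_j01, ?_, lambda1_unitDisk, integral_norm_diskIndicator_sq,
    lambda1_rpow_mul_integral, pi_div_j01_lt, ?_, not_fourierWeightedInequality⟩
  · rw [lambda1_unitDisk]
    exact isLeast_dirichletEigenvalue
  · rw [lambda1_rpow_mul_integral, integral_fourierPlane_weighted_eq]
    exact pi_div_j01_lt
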